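/- For a commutative ring $A$ and an ideal $I\subseteq A$, the \emph{inner integral closure} $I_{>1}$ of $I$ is the set of $r\in A$ satisfying an equation $r^d+a_1r^{d-1}+\cdots+a_d=0$ for some $d\ge 1$ with $a_j\in I^{j+1}$ for $1\le j\le d$. For a finitely generated $\mathbb{C}$-algebra $A$ with associated affine algebraic set $X$ (the set of $\mathbb{C}$-algebra homomorphisms $A\to\mathbb{C}$, with the Euclidean topology), let $\mathcal{C}(X)$ be the ring of continuous functions $X\to\mathbb{C}$; the \emph{continuous closure} $I^{\mathrm{cont}}$ of an ideal $I\subseteq A$ is the contraction of $I\,\mathcal{C}(X)$ to $A$ along the natural map $A\to\mathcal{C}(X)$. Let $R=\mathbb{C}[x_1,\dots,x_n]$, let $S$ be a localization of $R$ at one element, let $f\in R$, and let $\mathcal{J}=(\partial f/\partial x_1,\dots,\partial f/\partial x_n)\subseteq R$. (a) If $f$ is nonconstant, then there exists $g\in R$ such that $(1-gf)f$ is in the inner integral closure of $\mathcal{J}$ and in the continuous closure of $\mathcal{J}$; and there exists $g\in S$ such that $(1-gf)f$ is in the inner integral closure of $\mathcal{J}S$ and in the continuous closure of $\mathcal{J}S$.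 (b) If $f\in\mathrm{Rad}(\mathcal{J}S)$, then $f$ is in the inner integral closure of $\mathcal{J}S$ and in the continuous closure of $\mathcal{J}S$. -/

import Mathlib

/-- The `J`-special integral closure of an ideal `I`: the elements `r` that are a root of a monic
polynomial of some degree `d ≥ 1` whose coefficient `a j` of `x ^ (d - j)` lies in `J * I ^ j` for
`1 ≤ j ≤ d`. -/
def specialIntegralClosure {R : Type*} [CommRing R] (J I : Ideal R) : Set R :=
  {r | ∃ (d : ℕ) (a : ℕ → R), 1 ≤ d ∧ (∀ j ∈ Finset.Icc 1 d, a j ∈ J * I ^ j) ∧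
    r ^ d + ∑ j ∈ Finset.Icc 1 d, a j * r ^ (d - j) = 0}

/-- The inner integral closure of `I`: the `I`-special integral closure of `I`. -/
def innerIntegralClosure {R : Type*} [CommRing R] (I : Ideal R) : Set R :=
  specialIntegralClosure I I

/-- The points of the affine algebraic set of a `ℂ`-algebra `R`, as `ℂ`-algebra maps `R → ℂ`.
For a presentation `R = ℂ[x₁, …, xₘ] / 𝔄`, such a map is the evaluation at a point of the zero set
of `𝔄` in `ℂᵐ`. -/
def ComplexPoints (R : Type*) [CommRing R] [Algebra ℂ R] : Type _ := R →ₐ[ℂ] ℂ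

/-- The value at a point `x` of the function defined by `r`. -/
def ComplexPoints.value {R : Type*} [CommRing R] [Algebra ℂ R] (x : ComplexPoints R) (r : R) : ℂ :=
  (show R →ₐ[ℂ] ℂ from x) r

/-- The Euclidean topology: the coarsest one for which all `r ∈ R` are continuous functions; for
finitely generated `R` it is the subspace topology of any presentation
(`ComplexPoints.isInducing_coordinates`). -/
noncomputable instance ComplexPoints.instTopologicalSpace (R : Type*) [CommRing R] [Algebra ℂ R] :
    TopologicalSpace (ComplexPoints R) :=
  TopologicalSpace.induced (fun x r => x.value r) inferInstance

theorem ComplexPoints.continuous_value {R : Type*} [CommRing R] [Algebra ℂ R] (r : R) :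
    Continuous (fun x : ComplexPoints R => x.value r) :=
  (continuous_apply r).comp continuous_induced_dom

/-- If `v` generates `R` as a `ℂ`-algebra, the topology on the points is the one that the
coordinates `v i` induce from `ℂᵐ`. -/
theorem ComplexPoints.isInducing_coordinates {R : Type*} [CommRing R] [Algebra ℂ R] {m : ℕ}
    (v : Fin m → R) (hv : Algebra.adjoin ℂ (Set.range v) = ⊤) :
    Topology.IsInducing (fun (x : ComplexPoints R) (i : Fin m) => x.value (v i)) := by
  constructor
  apply le_antisymm
  · exact continuous_iff_le_induced.1
      (continuous_pi fun i => ComplexPoints.continuous_value (v i))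
  · let t : TopologicalSpace (ComplexPoints R) :=
      TopologicalSpace.induced (fun (x : ComplexPoints R) (i : Fin m) => x.value (v i)) inferInstance
    have key : ∀ r : R, @Continuous _ _ t _ (fun x : ComplexPoints R => x.value r) := by
      intro r
      have hr : r ∈ Algebra.adjoin ℂ (Set.range v) := hv ▸ Algebra.mem_top
      induction hr using Algebra.adjoin_induction with
      | mem r h =>
        obtain ⟨i, rfl⟩ := h
        have hc : Continuous (fun (x : ComplexPoints R) (i : Fin m) => x.value (v i)) :=
          continuous_induced_dom
        exact continuous_pi_iff.1 hc i
      | algebraMap c =>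
        have : (fun x : ComplexPoints R => x.value (algebraMap ℂ R c)) = fun _ => c := by
          funext x
          exact AlgHom.commutes (show R →ₐ[ℂ] ℂ from x) c
        rw [this]
        exact continuous_const
      | add a b _ _ ha hb =>
        have : (fun x : ComplexPoints R => x.value (a + b)) =
            fun x => x.value a + x.value b := by
          funext x
          exact map_add (show R →ₐ[ℂ] ℂ from x) a b
        rw [this]
        exact ha.add hb
      | mul a b _ _ ha hb =>
        have : (fun x : ComplexPoints R => x.value (a * b)) =
            fun x => x.value a * x.value b := by
          funext x
          exact map_mul (show R →ₐ[ℂ] ℂ from x) a b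
        rw [this]
        exact ha.mul hb
    exact continuous_iff_le_induced.1 (continuous_pi key)

/-- The natural map from `R` to the ring of continuous complex functions on its points. -/
noncomputable def toContinuousFunctions (R : Type*) [CommRing R] [Algebra ℂ R] :
    R →+* C(ComplexPoints R, ℂ) where
  toFun r := ⟨fun x => x.value r, ComplexPoints.continuous_value r⟩
  map_one' := by ext x; exact map_one (show R →ₐ[ℂ] ℂ from x)
  map_mul' a b := by ext x; exact map_mul (show R →ₐ[ℂ] ℂ from x) a b
  map_zero' := by ext x; exact map_zero (show R →ₐ[ℂ] ℂ from x)
  map_add' a b := by ext x; exact map_add (show R →ₐ[ℂ] ℂ from x) a b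

/-- The continuous closure of `I`: the contraction to `R` of the ideal that `I` generates in the
ring of continuous complex functions. -/
noncomputable def continuousClosure {R : Type*} [CommRing R] [Algebra ℂ R] (I : Ideal R) : Ideal R :=
  (I.map (toContinuousFunctions R)).comap (toContinuousFunctions R)

/-- The ideal generated by the partial derivatives of a polynomial. -/
noncomputable def jacobianIdeal {n : ℕ} (f : MvPolynomial (Fin n) ℂ) : Ideal (MvPolynomial (Fin n) ℂ) :=
  Ideal.span (Set.range fun i : Fin n => MvPolynomial.pderiv i f)

/-! Everything rests on one principle: on an affine variety in characteristic zero, a nonzero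
function coming from a polynomial `r` that divides all its partial derivatives is a unit
(`MvPolynomial.isUnit_algebraMap_of_dvd_pderiv`). At a zero of it, curve selection gives a formal
branch along which `r` becomes a nonzero power series without constant term. By the chain rule this
series divides its derivative, which is impossible.

If the partials of `r` lie in `I`, apply this to the algebra `S[I/r]` inside the fraction field:
there `r` divides its partials, so `1/r` lies in `S[I/r]`. Clearing denominators, with `r` in the
radical of `I` supplying two extra factors from `I`, gives an inner integral equation. This is (b)
when `S` is nonzero.

For (a), the same principle on the components of the critical locus shows that `f` has finitely many
critical values, so `q(f)` is in the radical of the Jacobian ideal for some `q ≠ 0`. Removing the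
factors `X` from `q` yields `p` with `p(0) ≠ 0`, and `f * p(f) / p(0)` has the form `(1 - g * f) *
f` and satisfies the hypotheses of the previous paragraph.

Continuous closure follows from inner integral closure: the extra factor of `I` in each coefficient
makes `r` small compared with the generators near their common zeros, so explicit quotients extend
continuously by zero. -/

open Topology Filter
open scoped Polynomial

/-! ### Formal branches and curve selection -/

/-- The Taylor expansion at a point whose ideal is principal. -/
theorem exists_injective_algHom_powerSeries_of_ker_eq_span {k V : Type*} [Field k] [CommRing V]
    [IsDomain V] [IsNoetherianRing V] [Algebra k V] (c : V →ₐ[k] k) (ϖ : V) (hϖ : ϖ ≠ 0)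
    (hker : RingHom.ker c = Ideal.span {ϖ}) :
    ∃ φ : V →ₐ[k] PowerSeries k, Function.Injective φ ∧
      ∀ x, PowerSeries.constantCoeff (φ x) = c x := by
  have ht : ∀ x : V, ∃ t : V, x = algebraMap k V (c x) + ϖ * t := by
    intro x
    have : x - algebraMap k V (c x) ∈ RingHom.ker c := by simp [RingHom.mem_ker]
    rw [hker, Ideal.mem_span_singleton] at this
    obtain ⟨t, ht⟩ := this
    exact ⟨t, by rw [← ht]; ring⟩
  choose t ht using ht
  have t_unique : ∀ (x y : V) (a : k), x = algebraMap k V a + ϖ * y → t x = y := by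
    intro x y a h
    have hcϖ : c ϖ = 0 := by
      rw [← RingHom.mem_ker, hker]; exact Ideal.mem_span_singleton_self ϖ
    have ha : c x = a := by rw [h]; simp [hcϖ]
    have h2 := ht x
    rw [ha] at h2
    exact mul_left_cancel₀ hϖ (add_left_cancel (h2.symm.trans h))
  have t_add : ∀ x y, t (x + y) = t x + t y := by
    intro x y
    apply t_unique _ _ (c x + c y)
    conv_lhs => rw [ht x, ht y]
    rw [map_add]; ring
  -- The twisted Leibniz rule of the difference quotient `t`; it is what makes the Taylor series
  -- multiplicative.
  have t_mul : ∀ x y, t (x * y) = t x * y + algebraMap k V (c x) * t y := by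
    intro x y
    apply t_unique _ _ (c x * c y)
    rw [map_mul]
    linear_combination y * ht x + algebraMap k V (c x) * ht y
  have t_alg : ∀ a, t (algebraMap k V a) = 0 := fun a => t_unique _ _ a (by simp)
  have t_zero : t 0 = 0 := by simpa using t_alg 0
  let F : V → PowerSeries k := fun x => PowerSeries.mk fun n => c (t^[n] x)
  have F_eq : ∀ x, F x = PowerSeries.C (c x) + PowerSeries.X * F (t x) := by
    intro x
    ext n
    cases n with
    | zero => simp [F]
    | succ n => simp [F, PowerSeries.coeff_succ_X_mul]
  have titer_add : ∀ n x y, t^[n] (x + y) = t^[n] x + t^[n] y := by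
    intro n
    induction n with
    | zero => simp
    | succ n ih => intro x y; simp [t_add, ih]
  have titer_zero : ∀ n, t^[n] 0 = 0 := fun n => Function.iterate_fixed t_zero n
  have F_add : ∀ x y, F (x + y) = F x + F y := by
    intro x y; ext n; simp [F, titer_add]
  have F_alg : ∀ a, F (algebraMap k V a) = PowerSeries.C a := by
    intro a
    have h0 : F 0 = 0 := by ext n; simp [F, titer_zero]
    rw [F_eq, t_alg, h0]; simp
  have F_mul_coeff : ∀ n x y, PowerSeries.coeff n (F (x * y)) = PowerSeries.coeff n (F x * F y) := by
    intro n
    induction n with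
    | zero => intro x y; simp [F]
    | succ n ih =>
      intro x y
      have e1 : F x * F y = PowerSeries.C (c x) * F y + PowerSeries.X * (F (t x) * F y) := by
        conv_lhs => rw [F_eq x]
        ring
      rw [e1, F_eq (x * y), t_mul, F_add, map_add, map_add, PowerSeries.coeff_succ_X_mul,
        PowerSeries.coeff_succ_X_mul, map_add, ih, ih, F_alg, F_eq y]
      simp only [PowerSeries.coeff_C_mul, map_add, PowerSeries.coeff_succ_X_mul]
      simp
      ring
  let φ : V →ₐ[k] PowerSeries k :=
    { toFun := F
      map_one' := by simpa using F_alg 1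
      map_mul' := fun x y => by ext n; exact F_mul_coeff n x y
      map_zero' := by simpa using F_alg 0
      map_add' := F_add
      commutes' := F_alg }
  refine ⟨φ, ?_, fun x => ?_⟩
  swap
  · change PowerSeries.constantCoeff (F x) = c x
    simp [F]
  rw [injective_iff_map_eq_zero]
  intro x hx
  have hc : ∀ n, c (t^[n] x) = 0 := by
    intro n
    have : PowerSeries.coeff n (F x) = 0 := by
      rw [show F x = 0 from hx, map_zero]
    simpa [F] using this
  -- A vanishing Taylor series puts `x` in every power of `(ϖ)`; Krull's intersection theorem then
  -- gives `x = 0`.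
  have hpow : ∀ n, x = ϖ ^ n * t^[n] x := by
    intro n
    induction n with
    | zero => simp
    | succ n ih =>
      have h := ht (t^[n] x)
      rw [hc n, map_zero, zero_add] at h
      rw [Function.iterate_succ_apply', pow_succ, mul_assoc, ← h]
      exact ih
  have hne : Ideal.span {ϖ} ≠ ⊤ := hker ▸ RingHom.ker_ne_top c
  have hbot := Ideal.iInf_pow_eq_bot_of_isDomain (Ideal.span {ϖ}) hne
  have : x ∈ (⨅ n : ℕ, Ideal.span {ϖ} ^ n) := by
    rw [Ideal.mem_iInf]
    intro n
    rw [Ideal.span_singleton_pow, Ideal.mem_span_singleton]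
    exact ⟨_, hpow n⟩
  rwa [hbot] at this

/-- A point of an affine algebra with an integral extension that is a Dedekind domain lies on a
formal branch. -/
theorem exists_injective_algHom_powerSeries_of_isDedekindDomain {k E O : Type*} [Field k]
    [IsAlgClosed k] [CommRing E] [Algebra k E] [CommRing O] [IsDedekindDomain O] [Algebra k O]
    [Algebra E O] [IsScalarTower k E O] [Algebra.FiniteType k O] [Algebra.IsIntegral E O]
    (hinj : Function.Injective (algebraMap E O)) (ψ : E →ₐ[k] k) (hψ : RingHom.ker ψ ≠ ⊥) :
    ∃ φ : E →ₐ[k] PowerSeries k, Function.Injective φ ∧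
      ∀ x, PowerSeries.constantCoeff (φ x) = ψ x := by
  have hker : RingHom.ker (algebraMap E O) ≤ RingHom.ker ψ := by
    rw [(RingHom.injective_iff_ker_eq_bot (algebraMap E O)).1 hinj]; exact bot_le
  have ψsurj : Function.Surjective ψ := fun a => ⟨algebraMap k E a, by simp⟩
  have : (RingHom.ker ψ).IsMaximal := RingHom.ker_isMaximal_of_surjective _ ψsurj
  obtain ⟨P, hP, hPψ⟩ := Ideal.exists_ideal_over_maximal_of_isIntegral (RingHom.ker ψ) hker
  have hP_mem : ∀ e, algebraMap E O e ∈ P ↔ ψ e = 0 := fun e => by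
    rw [← RingHom.mem_ker, ← hPψ]; rfl
  have hPbot : P ≠ ⊥ := by
    rintro rfl
    apply hψ
    rw [← hPψ]
    exact Ideal.comap_bot_of_injective _ hinj
  let : Field (O ⧸ P) := Ideal.Quotient.field P
  have : Module.Finite k (O ⧸ P) := finite_of_finite_type_of_isJacobsonRing k (O ⧸ P)
  have hbij : Function.Bijective (algebraMap k (O ⧸ P)) :=
    IsAlgClosed.algebraMap_bijective_of_isIntegral
  let c₀ : O →ₐ[k] k :=
    (AlgEquiv.ofBijective (Algebra.ofId k (O ⧸ P)) hbij).symm.toAlgHom.comp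
      (Ideal.Quotient.mkₐ k P)
  have hc₀ : ∀ x, c₀ x = 0 ↔ x ∈ P := by
    intro x
    simp [c₀, Ideal.Quotient.eq_zero_iff_mem]
  have hc₀ι : ∀ e, c₀ (algebraMap E O e) = ψ e := by
    intro e
    have h : c₀ (algebraMap E O (e - algebraMap k E (ψ e))) = 0 := by
      rw [hc₀]; exact (hP_mem _).2 (by simp)
    rw [map_sub, map_sub, ← IsScalarTower.algebraMap_apply, AlgHom.commutes, sub_eq_zero] at h
    simpa using h
  let V := Localization.AtPrime P
  have : IsDiscreteValuationRing V :=
    IsLocalization.AtPrime.isDiscreteValuationRing_of_dedekind_domain O hPbot V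
  let c : V →ₐ[k] k := IsLocalization.liftAlgHom (M := P.primeCompl) (f := c₀) fun y =>
    isUnit_iff_ne_zero.2 fun h => y.2 ((hc₀ _).1 h)
  have hc : ∀ x, c (algebraMap O V x) = c₀ x := fun x => by simp [c]
  have csurj : Function.Surjective c := fun a => ⟨algebraMap k V a, by simp⟩
  have hcmax : RingHom.ker c = IsLocalRing.maximalIdeal V :=
    IsLocalRing.eq_maximalIdeal (RingHom.ker_isMaximal_of_surjective _ csurj)
  obtain ⟨ϖ, hϖ⟩ := IsDiscreteValuationRing.exists_irreducible V
  obtain ⟨φ, φinj, hφ⟩ := exists_injective_algHom_powerSeries_of_ker_eq_span c ϖ hϖ.ne_zero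
    (hcmax.trans hϖ.maximalIdeal_eq)
  refine ⟨φ.comp ((IsScalarTower.toAlgHom k O V).comp (IsScalarTower.toAlgHom k E O)), ?_, ?_⟩
  · exact φinj.comp ((IsLocalization.injective V P.primeCompl_le_nonZeroDivisors).comp hinj)
  · intro x
    simp [hφ, hc, hc₀ι]

/-- A point of an integral curve over an algebraically closed field of characteristic zero lies on
a formal branch. -/
theorem exists_injective_algHom_powerSeries_of_finite_polynomial {k E : Type*} [Field k]
    [IsAlgClosed k] [CharZero k] [CommRing E] [IsDomain E] [Algebra k E] [Algebra k[X] E]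
    [IsScalarTower k k[X] E] [Module.Finite k[X] E]
    (hinj : Function.Injective (algebraMap k[X] E)) (ψ : E →ₐ[k] k) :
    ∃ φ : E →ₐ[k] PowerSeries k, Function.Injective φ ∧
      ∀ x, PowerSeries.constantCoeff (φ x) = ψ x := by
  let L := FractionRing E
  have : FaithfulSMul k[X] E := (faithfulSMul_iff_algebraMap_injective _ _).2 hinj
  have : FaithfulSMul k[X] L := by
    rw [faithfulSMul_iff_algebraMap_injective, IsScalarTower.algebraMap_eq k[X] E L]
    exact (IsFractionRing.injective E L).comp hinj
  let K := FractionRing k[X]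
  let : Algebra K L := FractionRing.liftAlgebra k[X] L
  have : IsScalarTower k[X] K L := FractionRing.isScalarTower_liftAlgebra k[X] L
  have : FiniteDimensional K L := inferInstance
  -- Characteristic zero makes `L / K` separable, hence the integral closure of `k[X]` in `L`
  -- finite.
  have : CharZero K := charZero_of_injective_algebraMap
    (R := k) (by
      rw [IsScalarTower.algebraMap_eq k k[X] K]
      exact (IsFractionRing.injective k[X] K).comp Polynomial.C_injective)
  let O := integralClosure k[X] L
  have : IsDedekindDomain O := integralClosure.isDedekindDomain k[X] K L
  let ι : E →ₐ[k[X]] O := IsIntegralClosure.lift k[X] O L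
  have hι : ∀ e, algebraMap O L (ι e) = algebraMap E L e := fun e =>
    IsIntegralClosure.algebraMap_lift k[X] O L e
  have ι_inj : Function.Injective ι := by
    intro a b hab
    apply IsFractionRing.injective E L
    rw [← hι, ← hι, hab]
  let : Algebra E O := ι.toRingHom.toAlgebra
  have : IsScalarTower k[X] E O := IsScalarTower.of_algebraMap_eq fun x => (ι.commutes x).symm
  have : Algebra.IsIntegral k[X] O := inferInstance
  have : Algebra.IsIntegral E O := Algebra.IsIntegral.tower_top k[X]
  have : IsScalarTower k E O := IsScalarTower.of_algebraMap_eq fun x => by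
    rw [IsScalarTower.algebraMap_apply k k[X] E, ← IsScalarTower.algebraMap_apply k[X] E O,
      ← IsScalarTower.algebraMap_apply k k[X] O]
  have : IsIntegralClosure O k[X] L := inferInstance
  have : Module.Finite k[X] O := IsIntegralClosure.finite k[X] K L O
  have : Algebra.FiniteType k O :=
    Algebra.FiniteType.trans (S := k[X]) inferInstance inferInstance
  refine exists_injective_algHom_powerSeries_of_isDedekindDomain (O := O) ι_inj ψ fun h => ?_
  -- A nonzero function vanishing at the point, so that the prime above it is nonzero and its
  -- localization is a discrete valuation ring.
  let a : k[X] := Polynomial.X - Polynomial.C (ψ (algebraMap k[X] E Polynomial.X))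
  have ha : algebraMap k[X] E a ∈ RingHom.ker ψ := by
    rw [RingHom.mem_ker]
    simp only [a, map_sub]
    rw [show algebraMap k[X] E (Polynomial.C (ψ (algebraMap k[X] E Polynomial.X))) =
      algebraMap k E (ψ (algebraMap k[X] E Polynomial.X)) from
      (IsScalarTower.algebraMap_apply k k[X] E _).symm]
    simp
  rw [h, Ideal.mem_bot, map_eq_zero_iff _ hinj] at ha
  exact Polynomial.X_sub_C_ne_zero _ ha

/-- Nullstellensatz: the residue field at a maximal ideal containing `w` is finite over `k`, hence
equal to `k`. -/
theorem exists_algHom_apply_eq_zero_of_not_isUnit {k A : Type*} [Field k] [IsAlgClosed k]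
    [CommRing A] [Algebra k A] [Algebra.FiniteType k A] {w : A} (hw : ¬ IsUnit w) :
    ∃ ψ : A →ₐ[k] k, ψ w = 0 := by
  obtain ⟨M, hM, hwM⟩ := exists_max_ideal_of_mem_nonunits hw
  let : Field (A ⧸ M) := Ideal.Quotient.field M
  have : Module.Finite k (A ⧸ M) := finite_of_finite_type_of_isJacobsonRing k (A ⧸ M)
  have hbij : Function.Bijective (algebraMap k (A ⧸ M)) :=
    IsAlgClosed.algebraMap_bijective_of_isIntegral
  refine ⟨(AlgEquiv.ofBijective (Algebra.ofId k (A ⧸ M)) hbij).symm.toAlgHom.comp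
      (Ideal.Quotient.mkₐ k M), ?_⟩
  simpa [Ideal.Quotient.eq_zero_iff_mem] using hwM

/-- Curve selection: through a zero of a nonzero function on an affine variety passes a formal
branch of a curve on which that function does not vanish identically. -/
theorem exists_algHom_powerSeries_ne_zero {k A : Type*} [Field k] [IsAlgClosed k] [CharZero k]
    [CommRing A] [IsDomain A] [Algebra k A] [Algebra.FiniteType k A] {w : A} (hw0 : w ≠ 0)
    (ψ : A →ₐ[k] k) (hψ : ψ w = 0) :
    ∃ φ : A →ₐ[k] PowerSeries k, φ w ≠ 0 ∧ ∀ x, PowerSeries.constantCoeff (φ x) = ψ x := by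
  -- After Noether normalization, the curve is a component of the preimage of a line through the
  -- image `p` of the point. The line is chosen not to lie in the zero set of `w₀`, a nonzero
  -- multiple of `w` from the polynomial ring.
  obtain ⟨m, g, ginj, gfin⟩ := exists_finite_inj_algHom_of_fg k A
  let : Algebra (MvPolynomial (Fin m) k) A := g.toRingHom.toAlgebra
  have : Module.Finite (MvPolynomial (Fin m) k) A := gfin
  have : FaithfulSMul (MvPolynomial (Fin m) k) A :=
    (faithfulSMul_iff_algebraMap_injective _ _).2 ginj
  have : IsScalarTower k (MvPolynomial (Fin m) k) A :=
    IsScalarTower.of_algebraMap_eq fun x => (g.commutes x).symm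
  obtain ⟨w₀, hw₀, hdvd⟩ := IsAlgebraic.exists_nonzero_dvd (R := MvPolynomial (Fin m) k)
    (Algebra.IsAlgebraic.isAlgebraic w) (mem_nonZeroDivisors_of_ne_zero hw0)
  replace hdvd : w ∣ g w₀ := hdvd
  let p : Fin m → k := fun i => ψ (g (MvPolynomial.X i))
  have hp : ∀ u, ψ (g u) = MvPolynomial.aeval p u := fun u => by
    have : ψ.comp g = MvPolynomial.aeval p := by ext i; simp [p]
    exact DFunLike.congr_fun this u
  have hw₀p : MvPolynomial.aeval p w₀ = 0 := by
    rw [← hp]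
    obtain ⟨b, hb⟩ := hdvd
    rw [hb, map_mul, hψ, zero_mul]
  obtain ⟨b, hb⟩ : ∃ b : Fin m → k, MvPolynomial.aeval b w₀ ≠ 0 := by
    by_contra! h
    exact hw₀ (MvPolynomial.funext fun x => by simpa [MvPolynomial.aeval_eq_eval] using h x)
  let ev : MvPolynomial (Fin m) k →ₐ[k] k[X] :=
    MvPolynomial.aeval fun i => Polynomial.C (p i) + Polynomial.C (b i - p i) * Polynomial.X
  have ev0 : ∀ u, Polynomial.aeval (0 : k) (ev u) = MvPolynomial.aeval p u := fun u => by
    have : (Polynomial.aeval (0 : k)).comp ev = MvPolynomial.aeval p := by ext i; simp [ev]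
    exact DFunLike.congr_fun this u
  have ev1 : ∀ u, Polynomial.aeval (1 : k) (ev u) = MvPolynomial.aeval b u := fun u => by
    have : (Polynomial.aeval (1 : k)).comp ev = MvPolynomial.aeval b := by ext i; simp [ev]
    exact DFunLike.congr_fun this u
  obtain ⟨i, hi⟩ : ∃ i, b i - p i ≠ 0 := by
    by_contra! h
    have : b = p := funext fun i => sub_eq_zero.1 (h i)
    exact hb (this ▸ hw₀p)
  -- An affine-linear function that restricts to the parameter of the line, giving a section of
  -- `ev`.
  let y : MvPolynomial (Fin m) k :=
    MvPolynomial.C (b i - p i)⁻¹ * (MvPolynomial.X i - MvPolynomial.C (p i))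
  have evy : ev y = Polynomial.X := by
    simp only [y, ev, map_mul, map_sub, MvPolynomial.aeval_X, MvPolynomial.algHom_C,
      Polynomial.algebraMap_eq]
    rw [← map_sub, add_sub_cancel_left, ← mul_assoc, ← Polynomial.C_mul, inv_mul_cancel₀ hi,
      Polynomial.C_1, one_mul]
  have ev_surj : ∀ h : k[X], ev (Polynomial.aeval y h) = h := fun h => by
    rw [← Polynomial.aeval_algHom_apply, evy, Polynomial.aeval_X_left_apply]
  have hle : RingHom.ker ev ≤ (RingHom.ker ψ).under (MvPolynomial (Fin m) k) := by
    intro u hu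
    change ψ (g u) = 0
    rw [hp, ← ev0, (RingHom.mem_ker).1 hu, map_zero]
  have : (RingHom.ker ev).IsPrime := RingHom.ker_isPrime _
  have : (RingHom.ker ψ).IsPrime := RingHom.ker_isPrime _
  -- Going down is needed, not just lying over: the curve cut out by `Q` must pass through the given
  -- point `ψ`.
  obtain ⟨Q, hQ, hQprime, hQover⟩ := Ideal.exists_ideal_le_liesOver_of_le (RingHom.ker ψ) hle
  have hQev : ∀ u, g u ∈ Q ↔ ev u = 0 := fun u => by
    rw [← RingHom.mem_ker, hQover.over]; rfl
  have hwQ : w ∉ Q := by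
    intro h
    obtain ⟨a, ha⟩ := hdvd
    have : g w₀ ∈ Q := ha ▸ Q.mul_mem_right a h
    rw [hQev] at this
    exact hb (by rw [← ev1, this, map_zero])
  let θ : k[X] →ₐ[k] A ⧸ Q := Polynomial.aeval (Ideal.Quotient.mk Q (g y))
  have hθ : ∀ u, θ (ev u) = Ideal.Quotient.mk Q (g u) := by
    intro u
    have h1 : g (Polynomial.aeval y (ev u) - u) ∈ Q := by
      rw [hQev, map_sub, ev_surj, sub_self]
    rw [← Ideal.Quotient.eq_zero_iff_mem, map_sub, map_sub, sub_eq_zero] at h1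
    rw [← h1, ← Polynomial.aeval_algHom_apply]
    exact (Polynomial.aeval_algHom_apply (Ideal.Quotient.mkₐ k Q) (g y) (ev u))
  let : Algebra k[X] (A ⧸ Q) := θ.toRingHom.toAlgebra
  have : IsScalarTower k k[X] (A ⧸ Q) :=
    IsScalarTower.of_algebraMap_eq fun x => (θ.commutes x).symm
  have : Module.Finite k[X] (A ⧸ Q) := by
    have h : ((Ideal.Quotient.mk Q).comp g.toRingHom).Finite :=
      (RingHom.Finite.of_surjective _ Ideal.Quotient.mk_surjective).comp gfin
    have h2 : (Ideal.Quotient.mk Q).comp g.toRingHom = θ.toRingHom.comp ev.toRingHom :=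
      RingHom.ext fun u => (hθ u).symm
    rw [h2] at h
    exact RingHom.Finite.of_comp_finite h
  have θinj : Function.Injective (algebraMap k[X] (A ⧸ Q)) := by
    rw [injective_iff_map_eq_zero]
    intro h hh
    rw [← ev_surj h] at hh ⊢
    rw [← hQev, ← Ideal.Quotient.eq_zero_iff_mem, ← hθ]
    exact hh
  obtain ⟨φ, φinj, hφ⟩ := exists_injective_algHom_powerSeries_of_finite_polynomial θinj
    (Ideal.Quotient.liftₐ Q ψ fun a ha => hQ ha)
  refine ⟨φ.comp (Ideal.Quotient.mkₐ k Q), ?_, fun x => ?_⟩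
  · simp only [AlgHom.comp_apply, Ideal.Quotient.mkₐ_eq_mk]
    rw [Ne, map_eq_zero_iff _ φinj, Ideal.Quotient.eq_zero_iff_mem]
    exact hwQ
  · rw [AlgHom.comp_apply, hφ]; rfl

/-! ### Functions dividing their partial derivatives; critical values -/

/-- Differentiation lowers a positive finite order by exactly one in characteristic zero. -/
theorem PowerSeries.eq_zero_of_dvd_derivative {k : Type*} [Field k] [CharZero k]
    {F : PowerSeries k} (h0 : PowerSeries.constantCoeff F = 0)
    (h : F ∣ PowerSeries.derivative k F) : F = 0 := by
  obtain ⟨G, hG⟩ := h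
  ext n
  rw [map_zero]
  induction n using Nat.strong_induction_on with
  | _ n ih =>
    cases n with
    | zero => simpa using h0
    | succ n =>
      have h1 := congrArg (PowerSeries.coeff n) hG
      rw [PowerSeries.coeff_derivative, PowerSeries.coeff_mul, Finset.sum_eq_zero] at h1
      · exact (mul_eq_zero.1 h1).resolve_right (by exact_mod_cast Nat.succ_ne_zero n)
      · intro x hx
        rw [ih x.1 (by have := Finset.HasAntidiagonal.mem_antidiagonal.1 hx; omega), zero_mul]

/-- The chain rule along a formal curve. -/
theorem MvPolynomial.derivative_algHom_powerSeries {k σ : Type*} [Field k] [Fintype σ]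
    (φ : MvPolynomial σ k →ₐ[k] PowerSeries k) (f : MvPolynomial σ k) :
    PowerSeries.derivative k (φ f) =
      ∑ i, φ (MvPolynomial.pderiv i f) * PowerSeries.derivative k (φ (MvPolynomial.X i)) := by
  classical
  induction f using MvPolynomial.induction_on with
  | C a => simp [MvPolynomial.algHom_C]
  | add p q hp hq => simp [hp, hq, add_mul, Finset.sum_add_distrib]
  | mul_X p j hp =>
    simp only [map_mul, Derivation.leibniz, smul_eq_mul, map_add, add_mul, Finset.sum_add_distrib,
      hp, MvPolynomial.pderiv_X, Pi.single_apply]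
    rw [Finset.mul_sum]
    congr 1
    · simp [Finset.sum_ite_eq]
    · exact Finset.sum_congr rfl fun i _ => by ring

/-- A polynomial that divides its own partial derivatives on an affine variety vanishes identically
or nowhere. -/
theorem MvPolynomial.isUnit_algebraMap_of_dvd_pderiv {k A σ : Type*} [Field k] [IsAlgClosed k]
    [CharZero k] [Fintype σ] [CommRing A] [IsDomain A] [Algebra k A] [Algebra.FiniteType k A]
    [Algebra (MvPolynomial σ k) A] [IsScalarTower k (MvPolynomial σ k) A] {r : MvPolynomial σ k}
    (hr : algebraMap (MvPolynomial σ k) A r ≠ 0)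
    (h : ∀ i, algebraMap (MvPolynomial σ k) A r ∣
      algebraMap (MvPolynomial σ k) A (MvPolynomial.pderiv i r)) :
    IsUnit (algebraMap (MvPolynomial σ k) A r) := by
  by_contra hu
  obtain ⟨ψ, hψ⟩ := exists_algHom_apply_eq_zero_of_not_isUnit (k := k) hu
  obtain ⟨φ, hφ, hφψ⟩ := exists_algHom_powerSeries_ne_zero hr ψ hψ
  apply hφ
  apply PowerSeries.eq_zero_of_dvd_derivative (by rw [hφψ, hψ])
  have := MvPolynomial.derivative_algHom_powerSeries
    (φ.comp (IsScalarTower.toAlgHom k (MvPolynomial σ k) A)) r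
  rw [AlgHom.comp_apply, IsScalarTower.toAlgHom_apply] at this
  rw [this]
  exact Finset.dvd_sum fun i _ => Dvd.dvd.mul_right (map_dvd φ (h i)) _

/-- A polynomial takes only finitely many values at its critical points. -/
theorem MvPolynomial.exists_aeval_mem_radical_of_pderiv_mem {k σ : Type*} [Field k]
    [IsAlgClosed k] [CharZero k] [Fintype σ] (f : MvPolynomial σ k) (J : Ideal (MvPolynomial σ k))
    (hJ : ∀ i, MvPolynomial.pderiv i f ∈ J) :
    ∃ q : k[X], q ≠ 0 ∧ Polynomial.aeval f q ∈ J.radical := by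
  by_contra! h
  -- A prime `P` above `J` avoiding `M` is a subvariety of the critical locus on which `f` is
  -- transcendental. But subtracting from `f` its value at a point leaves a nonzero function with
  -- zero partials there, hence a unit, which still vanishes at the point.
  let M : Submonoid (MvPolynomial σ k) := (nonZeroDivisors k[X]).map (Polynomial.aeval f)
  have hdisj : Disjoint (J : Set (MvPolynomial σ k)) M := by
    rw [Set.disjoint_left]
    rintro _ hx ⟨q, hq, rfl⟩
    exact h q (nonZeroDivisors.ne_zero hq) (Ideal.le_radical hx)
  obtain ⟨P, hP, hJP, hPM⟩ := Ideal.exists_le_prime_disjoint J M hdisj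
  obtain ⟨ψ, -⟩ := exists_algHom_apply_eq_zero_of_not_isUnit (k := k)
    (A := MvPolynomial σ k ⧸ P) (w := 0) not_isUnit_zero
  let c := ψ (Ideal.Quotient.mk P f)
  have hr : algebraMap (MvPolynomial σ k) (MvPolynomial σ k ⧸ P) (f - MvPolynomial.C c) ≠ 0 := by
    rw [Ideal.Quotient.algebraMap_eq, Ne, Ideal.Quotient.eq_zero_iff_mem]
    intro hmem
    refine Set.disjoint_left.1 hPM hmem ⟨Polynomial.X - Polynomial.C c,
      mem_nonZeroDivisors_of_ne_zero (Polynomial.X_sub_C_ne_zero c), ?_⟩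
    simp [MvPolynomial.algebraMap_eq]
  have hu := MvPolynomial.isUnit_algebraMap_of_dvd_pderiv hr fun i => by
    have : algebraMap (MvPolynomial σ k) (MvPolynomial σ k ⧸ P)
        (MvPolynomial.pderiv i (f - MvPolynomial.C c)) = 0 := by
      rw [Ideal.Quotient.algebraMap_eq, Ideal.Quotient.eq_zero_iff_mem]
      simpa using hJP (hJ i)
    rw [this]
    exact dvd_zero _
  have h0 : ψ (algebraMap (MvPolynomial σ k) (MvPolynomial σ k ⧸ P) (f - MvPolynomial.C c)) = 0 := by
    rw [map_sub, map_sub, ← MvPolynomial.algebraMap_eq, ← IsScalarTower.algebraMap_apply,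
      AlgHom.commutes]
    simp [c]
  exact (hu.map ψ).ne_zero h0

/-! ### Inner integral equations from the Rees algebra -/

theorem mem_innerIntegralClosure_of_subsingleton {S : Type*} [CommRing S] [Subsingleton S]
    (I : Ideal S) (r : S) : r ∈ innerIntegralClosure I :=
  ⟨1, 0, le_rfl, fun _ _ => by simp, Subsingleton.elim _ _⟩

theorem zero_mem_innerIntegralClosure {S : Type*} [CommRing S] (I : Ideal S) :
    (0 : S) ∈ innerIntegralClosure I :=
  ⟨1, 0, le_rfl, fun _ _ => by simp, by simp⟩

/-- The image of the Rees algebra of `I` under `T ↦ r⁻¹`, that is, the algebra generated by the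
fractions `a / r` for `a ∈ I`. -/
noncomputable def divAlgebra {S : Type*} (K : Type*) [CommRing S] [Field K] [Algebra S K]
    (I : Ideal S) (r : S) : Subalgebra S K :=
  (reesAlgebra I).map (Polynomial.aeval (algebraMap S K r)⁻¹)

theorem mem_innerIntegralClosure_of_isUnit_divAlgebra {S K : Type*} [CommRing S] [Field K]
    [Algebra S K] [FaithfulSMul S K] {I : Ideal S} {r : S} (hr : r ≠ 0)
    (hu : IsUnit (algebraMap S (divAlgebra K I r) r)) (hrad : r ∈ I.radical) :
    r ∈ innerIntegralClosure I := by
  have hrK : algebraMap S K r ≠ 0 := by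
    rwa [Ne, FaithfulSMul.algebraMap_eq_zero_iff]
  obtain ⟨N, hN⟩ := hrad
  obtain ⟨b, hb⟩ := hu.exists_right_inv
  obtain ⟨p, hp, hpb⟩ := b.2
  have hpr : Polynomial.aeval (algebraMap S K r)⁻¹ p = (algebraMap S K r)⁻¹ := by
    refine hpb.trans (eq_inv_of_mul_eq_one_right ?_)
    exact congrArg Subtype.val hb
  -- Since `p(1/r) = 1/r`, each of the factors `r ^ (2 * N) * p ^ (2 * N)` and `r * X` takes the
  -- value `1` at `1/r`. The second kills the constant term. The first supplies `r ^ N * r ^ N ∈ I ^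
  -- 2`: one factor of `I` makes up for the shift of degree, the other is the inner one.
  let Q : S[X] := Polynomial.C (r ^ (2 * N)) * p ^ (2 * N) * (Polynomial.C r * Polynomial.X)
  have hQ : Polynomial.aeval (algebraMap S K r)⁻¹ Q = 1 := by
    simp only [Q, map_mul, map_pow, hpr, Polynomial.aeval_C, Polynomial.aeval_X]
    rw [← mul_pow, mul_inv_cancel₀ hrK, one_pow, one_mul]
  have hQ0 : Q.coeff 0 = 0 := by simp [Q, ← mul_assoc]
  have hQj : ∀ j, Q.coeff j ∈ I * I ^ j := by
    intro j
    cases j with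
    | zero => rw [hQ0]; exact zero_mem _
    | succ j =>
      have e : Q.coeff (j + 1) = r * (r ^ N * r ^ N) * (p ^ (2 * N)).coeff j := by
        simp only [Q]
        rw [← mul_assoc, Polynomial.coeff_mul_X, Polynomial.coeff_mul_C, Polynomial.coeff_C_mul]
        ring
      have hpj : (p ^ (2 * N)).coeff j ∈ I ^ j :=
        (mem_reesAlgebra_iff I _).1 (pow_mem hp _) j
      rw [e, mul_assoc, pow_succ', ← mul_assoc]
      exact Ideal.mul_mem_left _ _ (Ideal.mul_mem_mul (Ideal.mul_mem_mul hN hN) hpj)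
  -- The equation is `Q(1/r) = 1` multiplied by `r ^ d`; taking `d` one above the degree of `Q`
  -- ensures `1 ≤ d`.
  refine ⟨Q.natDegree + 1, fun j => -Q.coeff j, by omega, fun j _ => neg_mem (hQj j), ?_⟩
  apply FaithfulSMul.algebraMap_injective S K
  rw [Polynomial.aeval_eq_sum_range' (n := Q.natDegree + 2) (by omega), Finset.range_eq_Ico,
    Finset.sum_eq_sum_Ico_succ_bot (by omega), hQ0, zero_smul, zero_add] at hQ
  rw [map_zero, map_add, map_sum, map_pow]
  have := congrArg (fun z => algebraMap S K r ^ (Q.natDegree + 1) * z) hQ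
  simp only [mul_one] at this
  rw [← this, Finset.mul_sum, show Finset.Icc 1 (Q.natDegree + 1) =
    Finset.Ico (0 + 1) (Q.natDegree + 2) from rfl,
    ← Finset.sum_add_distrib]
  apply Finset.sum_eq_zero
  intro j hj
  rw [Finset.mem_Ico] at hj
  have hsplit : algebraMap S K r ^ (Q.natDegree + 1) =
      algebraMap S K r ^ (Q.natDegree + 1 - j) * algebraMap S K r ^ j := by
    rw [← pow_add]; congr 1; omega
  rw [hsplit, Algebra.smul_def, map_mul, map_neg, map_pow, inv_pow]
  field_simp
  ring

/-- A function in the radical of an ideal that contains its partial derivatives is in the inner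
integral closure of that ideal. -/
theorem MvPolynomial.algebraMap_mem_innerIntegralClosure {k S σ : Type*} [Field k] [IsAlgClosed k]
    [CharZero k] [Fintype σ] [CommRing S] [IsDomain S] [Algebra k S] [Algebra.FiniteType k S]
    [Algebra (MvPolynomial σ k) S] [IsScalarTower k (MvPolynomial σ k) S] (r : MvPolynomial σ k)
    (I : Ideal S) (h : ∀ i, algebraMap (MvPolynomial σ k) S (MvPolynomial.pderiv i r) ∈ I)
    (hrad : algebraMap (MvPolynomial σ k) S r ∈ I.radical) :
    algebraMap (MvPolynomial σ k) S r ∈ innerIntegralClosure I := by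
  set s := algebraMap (MvPolynomial σ k) S r with hs
  rcases eq_or_ne s 0 with h0 | h0
  · rw [h0]; exact zero_mem_innerIntegralClosure I
  have : IsNoetherianRing S := Algebra.FiniteType.isNoetherianRing k S
  let K := FractionRing S
  have hsK : algebraMap S K s ≠ 0 := by
    rwa [Ne, FaithfulSMul.algebraMap_eq_zero_iff]
  let A := divAlgebra K I s
  have : Algebra.FiniteType S A :=
    (Subalgebra.fg_iff_finiteType _).1
      (Subalgebra.FG.map _ (reesAlgebra.fg (IsNoetherian.noetherian I)))
  have : Algebra.FiniteType k A := Algebra.FiniteType.trans (S := S) inferInstance inferInstance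
  apply mem_innerIntegralClosure_of_isUnit_divAlgebra (K := K) h0 ?_ hrad
  have hAs : algebraMap (MvPolynomial σ k) A r = algebraMap S A s :=
    IsScalarTower.algebraMap_apply _ S A r
  change IsUnit (algebraMap S A s)
  rw [← hAs]
  apply MvPolynomial.isUnit_algebraMap_of_dvd_pderiv (k := k)
  · rw [hAs]
    intro h
    exact hsK (congrArg Subtype.val h)
  · intro i
    rw [hAs, IsScalarTower.algebraMap_apply (MvPolynomial σ k) S A]
    refine ⟨⟨_, Polynomial.monomial 1 (algebraMap (MvPolynomial σ k) S (MvPolynomial.pderiv i r)),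
      reesAlgebra.monomial_mem.2 (by simpa using h i), rfl⟩, Subtype.ext ?_⟩
    change algebraMap S K _ = algebraMap S K s * Polynomial.aeval _ (Polynomial.monomial 1 _)
    rw [Polynomial.aeval_monomial, pow_one, mul_left_comm, mul_inv_cancel₀ hsK, mul_one]

/-! ### Inner integral closure implies continuous closure -/

/-- Quantitative smallness of the roots of a monic polynomial with small lower coefficients. -/
theorem norm_lt_of_monic_root {z : ℂ} {d : ℕ} (hd : 1 ≤ d) {α : ℕ → ℂ} {ε η : ℝ}
    (hα : ∀ j ∈ Finset.Icc 1 d, ‖α j‖ ≤ ε) (hη : 0 < η) (hη1 : η ≤ 1) (hε : d * ε < η ^ d)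
    (hz : z ^ d + ∑ j ∈ Finset.Icc 1 d, α j * z ^ (d - j) = 0) : ‖z‖ < η := by
  have hε0 : 0 ≤ ε := (norm_nonneg _).trans (hα 1 (Finset.mem_Icc.2 ⟨le_rfl, hd⟩))
  have hbound : ∀ M : ℝ, 1 ≤ M → ‖z‖ ≤ M → ‖z‖ ^ d ≤ d * ε * M ^ (d - 1) := by
    intro M hM hzM
    calc ‖z‖ ^ d = ‖∑ j ∈ Finset.Icc 1 d, α j * z ^ (d - j)‖ := by
          rw [← norm_pow, eq_neg_of_add_eq_zero_left hz, norm_neg]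
      _ ≤ ∑ j ∈ Finset.Icc 1 d, ‖α j * z ^ (d - j)‖ := norm_sum_le _ _
      _ ≤ ∑ j ∈ Finset.Icc 1 d, ε * M ^ (d - 1) := by
          refine Finset.sum_le_sum fun j hj => ?_
          rw [norm_mul, norm_pow]
          refine mul_le_mul (hα j hj) ?_ (by positivity) hε0
          have hj' := Finset.mem_Icc.1 hj
          calc ‖z‖ ^ (d - j) ≤ M ^ (d - j) := by gcongr
            _ ≤ M ^ (d - 1) := pow_le_pow_right₀ hM (by omega)
      _ = d * ε * M ^ (d - 1) := by simp; ring
  rcases le_or_gt ‖z‖ 1 with h | h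
  · have := hbound 1 le_rfl h
    rw [one_pow, mul_one] at this
    exact lt_of_pow_lt_pow_left₀ d hη.le (this.trans_lt hε)
  · exfalso
    have := hbound ‖z‖ h.le le_rfl
    have hd' : ‖z‖ ^ d = ‖z‖ * ‖z‖ ^ (d - 1) := by rw [← pow_succ']; congr 1; omega
    rw [hd'] at this
    have h2 : ‖z‖ ≤ d * ε := le_of_mul_le_mul_right this (by positivity)
    have h3 : η ^ d ≤ 1 := pow_le_one₀ hη.le hη1
    linarith

/-- Continuity of `B` matters: it keeps the bound locally uniform near the zeros of `ρ`. -/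
theorem ContinuousMap.exists_norm_le_mul_pow_of_mem_span_pow {X : Type*} [TopologicalSpace X]
    {s : Set C(X, ℂ)} {ρ : X → ℝ} (hs : ∀ g ∈ s, ∀ x, ‖g x‖ ≤ ρ x) (j : ℕ) {a : C(X, ℂ)}
    (ha : a ∈ Ideal.span s ^ j) :
    ∃ B : C(X, ℝ), ∀ x, ‖a x‖ ≤ B x * ρ x ^ j := by
  have h1 : ∀ b ∈ Ideal.span s, ∃ B : C(X, ℝ), ∀ x, ‖b x‖ ≤ B x * ρ x := by
    intro b hb
    induction hb using Submodule.span_induction with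
    | mem g hg => exact ⟨1, fun x => by simpa using hs g hg x⟩
    | zero => exact ⟨0, fun x => by simp⟩
    | add b c _ _ hb hc =>
      obtain ⟨B, hB⟩ := hb
      obtain ⟨C, hC⟩ := hc
      refine ⟨B + C, fun x => (norm_add_le _ _).trans ?_⟩
      simpa [add_mul] using add_le_add (hB x) (hC x)
    | smul c b _ hb =>
      obtain ⟨B, hB⟩ := hb
      refine ⟨⟨fun x => ‖c x‖, by fun_prop⟩ * B, fun x => ?_⟩
      simpa [mul_assoc] using mul_le_mul_of_nonneg_left (hB x) (norm_nonneg (c x))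
  induction j generalizing a with
  | zero => exact ⟨⟨fun x => ‖a x‖, by fun_prop⟩, fun x => by simp⟩
  | succ j ih =>
    replace ha : a ∈ Ideal.span s ^ j * Ideal.span s := (pow_succ (Ideal.span s) j).le ha
    induction ha using Submodule.mul_induction_on' with
    | mem_mul_mem b hb c hc =>
      obtain ⟨B, hB⟩ := ih hb
      obtain ⟨C, hC⟩ := h1 c hc
      refine ⟨B * C, fun x => ?_⟩
      have := mul_le_mul (hB x) (hC x) (norm_nonneg _) ((norm_nonneg _).trans (hB x))
      rw [ContinuousMap.mul_apply, ContinuousMap.mul_apply, norm_mul]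
      exact this.trans_eq (by ring)
    | add b _ c _ hb hc =>
      obtain ⟨B, hB⟩ := hb
      obtain ⟨C, hC⟩ := hc
      refine ⟨B + C, fun x => (norm_add_le _ _).trans ?_⟩
      simpa [add_mul] using add_le_add (hB x) (hC x)

theorem ContinuousMap.mem_of_mem_innerIntegralClosure {X : Type*} [TopologicalSpace X]
    {I : Ideal C(X, ℂ)} (hI : I.FG) {r : C(X, ℂ)} (hr : r ∈ innerIntegralClosure I) : r ∈ I := by
  obtain ⟨s, rfl⟩ := hI
  obtain ⟨d, a, hd, ha, heq⟩ := hr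
  let G : X → ℝ := fun x => ∑ g ∈ s, ‖g x‖ ^ 2
  let ρ : X → ℝ := fun x => √(G x)
  have G_nonneg : ∀ x, 0 ≤ G x := fun x => Finset.sum_nonneg fun _ _ => by positivity
  have G_cont : Continuous G := by fun_prop
  have ρ_cont : Continuous ρ := G_cont.sqrt
  have ρ_nonneg : ∀ x, 0 ≤ ρ x := fun x => Real.sqrt_nonneg _
  have ρ_sq : ∀ x, ρ x ^ 2 = G x := fun x => Real.sq_sqrt (G_nonneg x)
  have hgρ : ∀ g ∈ (s : Set C(X, ℂ)), ∀ x, ‖g x‖ ≤ ρ x := fun g hg x =>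
    Real.le_sqrt_of_sq_le (Finset.single_le_sum (f := fun g : C(X, ℂ) => ‖g x‖ ^ 2)
      (fun _ _ => by positivity) hg)
  have hB : ∀ j, ∃ B : C(X, ℝ), j ∈ Finset.Icc 1 d → ∀ x, ‖a j x‖ ≤ B x * ρ x ^ (j + 1) := by
    intro j
    by_cases hj : j ∈ Finset.Icc 1 d
    · obtain ⟨B, hB⟩ := ContinuousMap.exists_norm_le_mul_pow_of_mem_span_pow hgρ (j + 1)
        ((pow_succ' (Ideal.span (s : Set C(X, ℂ))) j).ge (ha j hj))
      exact ⟨B, fun _ => hB⟩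
    · exact ⟨0, fun h => absurd h hj⟩
  choose B hB using hB
  let E : X → ℝ := fun x => (∑ j ∈ Finset.Icc 1 d, |B j x|) * ρ x
  have E_cont : Continuous E := by fun_prop
  have heq' : ∀ x, r x ^ d + ∑ j ∈ Finset.Icc 1 d, a j x * r x ^ (d - j) = 0 := fun x => by
    simpa using congrArg (fun F : C(X, ℂ) => F x) heq
  -- Where `ρ ≠ 0`, `r / ρ` is a root of the monic polynomial with coefficients `a j / ρ ^ j`. These
  -- are bounded by `E`, which tends to zero at the zeros of `ρ` thanks to the one power of `ρ` left
  -- over.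
  have r_le : ∀ x η, 0 < η → η ≤ 1 → d * E x < η ^ d → ‖r x‖ ≤ η * ρ x := by
    intro x η hη hη1 hE
    rcases (ρ_nonneg x).eq_or_lt with h0 | h0
    · have hz : r x ^ d = 0 := by
        rw [← heq' x, left_eq_add]
        refine Finset.sum_eq_zero fun j hj => ?_
        have := hB j hj x
        rw [← h0, zero_pow (by omega), mul_zero, norm_le_zero_iff] at this
        rw [this, zero_mul]
      rw [pow_eq_zero_iff (by omega)] at hz
      rw [hz, ← h0]; simp
    · have hρ : (ρ x : ℂ) ≠ 0 := by exact_mod_cast h0.ne'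
      have hlt : ‖r x / ρ x‖ < η := by
        refine norm_lt_of_monic_root hd (α := fun j => a j x / (ρ x : ℂ) ^ j) (ε := E x) ?_ hη hη1
          hE ?_
        · intro j hj
          rw [norm_div, norm_pow, Complex.norm_real, Real.norm_of_nonneg h0.le,
            div_le_iff₀ (by positivity)]
          have h1 : |B j x| ≤ ∑ j ∈ Finset.Icc 1 d, |B j x| :=
            Finset.single_le_sum (f := fun j => |B j x|) (fun _ _ => abs_nonneg _) hj
          calc ‖a j x‖ ≤ B j x * ρ x ^ (j + 1) := hB j hj x
            _ ≤ (∑ j ∈ Finset.Icc 1 d, |B j x|) * ρ x ^ (j + 1) := by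
                gcongr; exact (le_abs_self _).trans h1
            _ = E x * ρ x ^ j := by simp only [E]; ring
        · have : (r x / ρ x) ^ d + ∑ j ∈ Finset.Icc 1 d, a j x / (ρ x : ℂ) ^ j *
              (r x / ρ x) ^ (d - j) =
              (r x ^ d + ∑ j ∈ Finset.Icc 1 d, a j x * r x ^ (d - j)) / (ρ x : ℂ) ^ d := by
            rw [add_div, Finset.sum_div, div_pow]
            congr 1
            refine Finset.sum_congr rfl fun j hj => ?_
            have hj' := Finset.mem_Icc.1 hj
            rw [div_pow, div_mul_div_comm, ← pow_add, Nat.add_sub_cancel' hj'.2]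
          rw [this, heq' x, zero_div]
      rw [norm_div, Complex.norm_real, Real.norm_of_nonneg h0.le, div_lt_iff₀ h0] at hlt
      exact hlt.le
  -- As `G = ∑ ‖g‖ ^ 2`, these satisfy `∑ h g * g = r` where `G ≠ 0`. Division by zero gives them
  -- the value `0` elsewhere, which is the continuous extension.
  let h : C(X, ℂ) → X → ℂ := fun g x => r x * starRingEnd ℂ (g x) / (G x : ℂ)
  have h_cont : ∀ g ∈ s, Continuous (h g) := by
    intro g hg
    rw [continuous_iff_continuousAt]
    intro x₀
    by_cases h0 : G x₀ = 0
    · have hh0 : h g x₀ = 0 := by simp [h, h0]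
      have hE0 : E x₀ = 0 := by simp [E, ρ, h0]
      rw [Metric.continuousAt_iff']
      intro η hη
      let η' := min (η / 2) 1
      have hη' : 0 < η' := by positivity
      have hev : ∀ᶠ x in 𝓝 x₀, d * E x < η' ^ d := by
        have hc : Continuous fun x => d * E x := by fun_prop
        exact (hc.tendsto x₀).eventually_lt_const (by rw [hE0, mul_zero]; positivity)
      filter_upwards [hev] with x hx
      rw [hh0, dist_zero_right]
      refine lt_of_le_of_lt ?_ ((min_le_left (η / 2) 1).trans_lt (half_lt_self hη))
      change ‖h g x‖ ≤ η'
      simp only [h]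
      rw [norm_div, norm_mul, RCLike.norm_conj, Complex.norm_real, Real.norm_of_nonneg (G_nonneg x)]
      refine div_le_of_le_mul₀ (G_nonneg x) hη'.le ?_
      calc ‖r x‖ * ‖g x‖ ≤ (η' * ρ x) * ρ x :=
            mul_le_mul (r_le x η' hη' (min_le_right _ _) hx) (hgρ g hg x) (norm_nonneg _)
              (mul_nonneg hη'.le (ρ_nonneg x))
        _ = η' * G x := by rw [← ρ_sq]; ring
    · refine ContinuousAt.div (by fun_prop) (by fun_prop) (by exact_mod_cast h0)
  have hsum : r = ∑ g ∈ s.attach, (⟨h g.1, h_cont g.1 g.2⟩ : C(X, ℂ)) * g.1 := by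
    ext x
    rw [ContinuousMap.sum_apply]
    simp only [ContinuousMap.mul_apply, ContinuousMap.coe_mk]
    rw [Finset.sum_attach s (fun g => h g x * g x)]
    by_cases h0 : G x = 0
    · have hρ0 : ρ x = 0 := by simp [ρ, h0]
      have := r_le x 1 one_pos le_rfl (by simp [E, hρ0])
      rw [hρ0, mul_zero, norm_le_zero_iff] at this
      simp [h, this]
    · have hG : (G x : ℂ) ≠ 0 := by exact_mod_cast h0
      have : ∀ g ∈ s, h g x * g x = r x / G x * ((‖g x‖ ^ 2 : ℝ) : ℂ) := by
        intro g _
        rw [Complex.ofReal_pow, ← Complex.conj_mul']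
        simp only [h]; ring
      rw [Finset.sum_congr rfl this, ← Finset.mul_sum, ← Complex.ofReal_sum]
      exact (div_mul_cancel₀ _ hG).symm
  rw [hsum]
  exact Ideal.sum_mem _ fun g _ => Ideal.mul_mem_left _ _ (Ideal.subset_span g.2)

theorem map_mem_innerIntegralClosure {R S : Type*} [CommRing R] [CommRing S] (φ : R →+* S)
    {I : Ideal R} {r : R} (hr : r ∈ innerIntegralClosure I) :
    φ r ∈ innerIntegralClosure (I.map φ) := by
  obtain ⟨d, a, hd, ha, heq⟩ := hr
  refine ⟨d, fun j => φ (a j), hd, fun j hj => ?_, ?_⟩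
  · rw [← Ideal.map_pow, ← Ideal.map_mul]
    exact Ideal.mem_map_of_mem φ (ha j hj)
  · simpa using congrArg φ heq

theorem mem_continuousClosure_of_mem_innerIntegralClosure {R : Type*} [CommRing R] [Algebra ℂ R]
    {I : Ideal R} (hI : I.FG) {r : R} (hr : r ∈ innerIntegralClosure I) :
    r ∈ continuousClosure I :=
  ContinuousMap.mem_of_mem_innerIntegralClosure (hI.map _) (map_mem_innerIntegralClosure _ hr)

/-! ### Removing the nonzero critical values, and the theorem -/

theorem MvPolynomial.exists_one_sub_mul_mul_mem_radical {k σ : Type*} [Field k]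
    [IsAlgClosed k] [CharZero k] [Fintype σ] (f : MvPolynomial σ k) (J : Ideal (MvPolynomial σ k))
    (hJ : ∀ i, MvPolynomial.pderiv i f ∈ J) :
    ∃ g : MvPolynomial σ k, (1 - g * f) * f ∈ J.radical ∧
      ∀ i, MvPolynomial.pderiv i ((1 - g * f) * f) ∈ J := by
  obtain ⟨q, hq, hqJ⟩ := MvPolynomial.exists_aeval_mem_radical_of_pderiv_mem f J hJ
  obtain ⟨p, hp, hpX⟩ := Polynomial.exists_eq_pow_rootMultiplicity_mul_and_not_dvd q hq 0
  generalize q.rootMultiplicity 0 = m at hp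
  rw [Polynomial.C_0, sub_zero] at hp hpX
  have hc : p.coeff 0 ≠ 0 := fun h => hpX (Polynomial.X_dvd_iff.2 h)
  have hpf : Polynomial.aeval f p = Polynomial.aeval f p.divX * f + MvPolynomial.C (p.coeff 0) := by
    conv_lhs => rw [← Polynomial.divX_mul_X_add p]
    simp [MvPolynomial.algebraMap_eq]
  have hC : MvPolynomial.C (p.coeff 0)⁻¹ * MvPolynomial.C (p.coeff 0) =
      (1 : MvPolynomial σ k) := by
    rw [← MvPolynomial.C_mul, inv_mul_cancel₀ hc, MvPolynomial.C_1]
  -- Chosen so that `1 - g * f = p(f) / p(0)`.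
  let g : MvPolynomial σ k := -(MvPolynomial.C (p.coeff 0)⁻¹ * Polynomial.aeval f p.divX)
  have hr : (1 - g * f) * f = MvPolynomial.C (p.coeff 0)⁻¹ * (Polynomial.aeval f p * f) := by
    rw [hpf]
    simp only [g]
    linear_combination -f * hC
  refine ⟨g, ?_, fun i => ?_⟩
  · rw [hr]
    refine Ideal.mul_mem_left _ _ (Ideal.mem_radical_of_pow_mem (m := m + 1) ?_)
    have : (Polynomial.aeval f p * f) ^ (m + 1) =
        Polynomial.aeval f p ^ m * f * Polynomial.aeval f q := by
      rw [hp]; simp only [map_mul, map_pow, Polynomial.aeval_X]; ring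
    rw [this]
    exact Ideal.mul_mem_left _ _ hqJ
  -- A polynomial in `f` has partials that are multiples of those of `f`.
  · have : (1 - g * f) * f =
        Polynomial.aeval f (Polynomial.C (p.coeff 0)⁻¹ * (p * Polynomial.X)) := by
      rw [hr]; simp [MvPolynomial.algebraMap_eq]
    rw [this, Derivation.map_aeval, smul_eq_mul]
    exact Ideal.mul_mem_left _ _ (hJ i)

theorem MvPolynomial.mem_innerIntegralClosure {k σ : Type*} [Field k] [IsAlgClosed k]
    [CharZero k] [Fintype σ] (r : MvPolynomial σ k) (I : Ideal (MvPolynomial σ k))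
    (h : ∀ i, MvPolynomial.pderiv i r ∈ I) (hrad : r ∈ I.radical) : r ∈ innerIntegralClosure I := by
  have := MvPolynomial.algebraMap_mem_innerIntegralClosure (k := k) (S := MvPolynomial σ k) r I
  simp only [Algebra.algebraMap_self, RingHom.id_apply] at this
  exact this h hrad

theorem mainTheorem8 (n : ℕ) (f : MvPolynomial (Fin n) ℂ) (h : MvPolynomial (Fin n) ℂ)
    (S : Type*) [CommRing S] [Algebra (MvPolynomial (Fin n) ℂ) S] [IsLocalization.Away h S]
    [Algebra ℂ S] [IsScalarTower ℂ (MvPolynomial (Fin n) ℂ) S] :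
    ((∀ c : ℂ, f ≠ MvPolynomial.C c) →
      (∃ g : MvPolynomial (Fin n) ℂ,
        (1 - g * f) * f ∈ innerIntegralClosure (jacobianIdeal f) ∧
        (1 - g * f) * f ∈ continuousClosure (jacobianIdeal f)) ∧
      (∃ g : S,
        (1 - g * algebraMap (MvPolynomial (Fin n) ℂ) S f) *
            algebraMap (MvPolynomial (Fin n) ℂ) S f ∈
          innerIntegralClosure
            ((jacobianIdeal f).map (algebraMap (MvPolynomial (Fin n) ℂ) S)) ∧
        (1 - g * algebraMap (MvPolynomial (Fin n) ℂ) S f) *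
            algebraMap (MvPolynomial (Fin n) ℂ) S f ∈
          continuousClosure
            ((jacobianIdeal f).map (algebraMap (MvPolynomial (Fin n) ℂ) S)))) ∧
    (algebraMap (MvPolynomial (Fin n) ℂ) S f ∈
        ((jacobianIdeal f).map (algebraMap (MvPolynomial (Fin n) ℂ) S)).radical →
      algebraMap (MvPolynomial (Fin n) ℂ) S f ∈
          innerIntegralClosure
            ((jacobianIdeal f).map (algebraMap (MvPolynomial (Fin n) ℂ) S)) ∧
        algebraMap (MvPolynomial (Fin n) ℂ) S f ∈
          continuousClosure
            ((jacobianIdeal f).map (algebraMap (MvPolynomial (Fin n) ℂ) S))) := by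
  have hJ : ∀ i, MvPolynomial.pderiv i f ∈ jacobianIdeal f := fun i => Ideal.subset_span ⟨i, rfl⟩
  have hFG : (jacobianIdeal f).FG := IsNoetherian.noetherian _
  have hFGS := hFG.map (algebraMap (MvPolynomial (Fin n) ℂ) S)
  refine ⟨fun _ => ?_, fun hrad => ?_⟩
  · obtain ⟨g, hg, hgJ⟩ := MvPolynomial.exists_one_sub_mul_mul_mem_radical f _ hJ
    have hr := MvPolynomial.mem_innerIntegralClosure _ _ hgJ hg
    have hrS := map_mem_innerIntegralClosure (algebraMap (MvPolynomial (Fin n) ℂ) S) hr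
    rw [map_mul, map_sub, map_one, map_mul] at hrS
    exact ⟨⟨g, hr, mem_continuousClosure_of_mem_innerIntegralClosure hFG hr⟩,
      ⟨_, hrS, mem_continuousClosure_of_mem_innerIntegralClosure hFGS hrS⟩⟩
  · suffices hfS : algebraMap (MvPolynomial (Fin n) ℂ) S f ∈ innerIntegralClosure
        ((jacobianIdeal f).map (algebraMap (MvPolynomial (Fin n) ℂ) S)) from
      ⟨hfS, mem_continuousClosure_of_mem_innerIntegralClosure hFGS hfS⟩
    -- Localizing at `h = 0` gives the zero ring, which is not a domain.
    rcases subsingleton_or_nontrivial S with hS | hS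
    · exact mem_innerIntegralClosure_of_subsingleton _ _
    · have hh : h ≠ 0 := by
        rintro rfl
        exact not_isUnit_zero (map_zero (algebraMap (MvPolynomial (Fin n) ℂ) S) ▸
          IsLocalization.Away.algebraMap_isUnit (S := S) (0 : MvPolynomial (Fin n) ℂ))
      have : IsDomain S := IsLocalization.isDomain_of_le_nonZeroDivisors (M := Submonoid.powers h) S
        (powers_le_nonZeroDivisors_of_noZeroDivisors hh)
      have : Algebra.FiniteType (MvPolynomial (Fin n) ℂ) S :=
        IsLocalization.finiteType_of_monoid_fg (Submonoid.powers h) S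
      have : Algebra.FiniteType ℂ S :=
        Algebra.FiniteType.trans (S := MvPolynomial (Fin n) ℂ) inferInstance inferInstance
      exact MvPolynomial.algebraMap_mem_innerIntegralClosure f _
        (fun i => Ideal.mem_map_of_mem _ (hJ i)) hrad
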